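/- Let $\mathbb R_+=(0,\infty)$ and let $|\cdot|_\infty$ be the sup-norm. A real $n\times m$ matrix $\Theta$ is called uniformly $\psi$-approximable if for every sufficiently large real $t$ there are $x\in\mathbb Z^m$, $y\in\mathbb Z^n$ with $0<|x|_\infty\le t$ and $|\Theta x-y|_\infty\le\psi(t)$. For a bijection $g:\mathbb R_+\to\mathbb R_+$ let $g^-$ be its inverse, and let ${}^t\Theta$ be the transpose of $\Theta$. Let $n=1$, $m=2$, let $\Theta$ be a real $1\times2$ matrix, and let $\psi:\mathbb R_+\to\mathbb R_+$ be a decreasing bijection such that $f(t)=t\psi(t)$ is also a bijection of $\mathbb R_+$ onto itself. Then: (i) if $f$ is decreasing and $\Theta$ is uniformly $\psi$-approximable, then ${}^t\Theta$ is uniformly $\phi$-approximable, where $\phi(t)=\frac{4}{3t}\,\psi^-\!\left(\frac{2}{3t}\right)$; (ii) if $f$ is increasing and ${}^t\Theta$ is uniformly $\psi$-approximable, then $\Theta$ is uniformly $\phi$-approximable, where $\phi(t)=\frac{2}{3f^-(t/2)}$. These functions improve Jarník's: for all $\varepsilon,\delta,t>0$ one has $\frac{4}{3t}\psi^-\!\left(\frac{2}{3t}\right)<\frac{12(1+\varepsilon+\delta)}{t}\psi^-\!\left(\frac1t\right)$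 if $f$ is decreasing, and $\frac{2}{3f^-(t/2)}<\frac{4(1+\varepsilon+\delta)}{f^-(t/2)}$ if $f$ is increasing. -/

import Mathlib

open Set Filter Matrix

/-- `Θ` is uniformly `ψ`-approximable: for every sufficiently large real `t` there are integer
vectors `x ∈ ℤ^m`, `y ∈ ℤ^n` with `0 < |x|_∞ ≤ t` and `|Θ x - y|_∞ ≤ ψ t`.
The norms below are the sup-norms of `Fin m → ℝ` and `Fin n → ℝ`. Only the values of `ψ` at
large positive arguments matter, so a function on the positive reals is given by any
extension of it to `ℝ`. -/
def UniformlyApproximable {n m : ℕ} (Θ : Matrix (Fin n) (Fin m) ℝ) (ψ : ℝ → ℝ) : Prop :=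
  ∀ᶠ t : ℝ in atTop, ∃ (x : Fin m → ℤ) (y : Fin n → ℤ),
    0 < ‖(fun j => (x j : ℝ))‖ ∧ ‖(fun j => (x j : ℝ))‖ ≤ t ∧
      ‖Θ *ᵥ (fun j => (x j : ℝ)) - (fun i => (y i : ℝ))‖ ≤ ψ t

/-- `g` is invertible as a map from the positive reals to the positive reals. -/
def PosInvertible (g : ℝ → ℝ) : Prop :=
  BijOn g (Ioi 0) (Ioi 0)

/-- The inverse function, on the positive reals, of a map that is invertible as a map from the
positive reals to the positive reals. -/
noncomputable def posInv (g : ℝ → ℝ) : ℝ → ℝ :=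
  Function.invFunOn g (Ioi 0)

theorem posInv_spec {g : ℝ → ℝ} (hg : PosInvertible g) {t : ℝ} (ht : 0 < t) :
    0 < posInv g t ∧ g (posInv g t) = t ∧ posInv g (g t) = t := by
  refine ⟨?_, ?_, ?_⟩
  · exact hg.surjOn.mapsTo_invFunOn ht
  · exact hg.surjOn.rightInvOn_invFunOn ht
  · exact hg.injOn.leftInvOn_invFunOn ht

open MeasureTheory Topology

/-!
The integers `(x, y)` for `Θ` and for `Θᵀ` parametrize two dual unimodular lattices `Λ`, `Λ*` in
`ℝ³`. Write a point as (head, tail) with head in `ℝ` and tail in `ℝ²`; approximability says that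
`Λ` meets certain boxes `|head| ≤ P`, `‖tail‖ ≤ R`, and we look for a point of `Λ*` in a
suitable box.

Let `v ∈ Λ` be a nonzero point with the smallest `|head|` in the box given by the hypothesis. The
section of a cube by a plane through its centre, projected along a suitable axis, contains a hexagon
with three quarters of the area of a face. Hence, if the target box meets the plane `v^⊥` in a large
enough section, Minkowski's theorem for the plane lattice `Λ* ∩ v^⊥` gives the point; it is applied
to a prism over the hexagon in `ℝ³`, so that no planar lattice is needed. Otherwise the head of `v`
is large compared with its tail. In that case let `w ∈ Λ` be a nonzero point of smaller `|head|`
whose tail is minimal: the cross product `v × w` belongs to `Λ*` and lies in the target box.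
-/

/-- The hexagon with vertices `±(1, 0)`, `±(0, 1)`, `±(1, -1)`. -/
def hexagon : Set (ℝ × ℝ) :=
  {p | |p.1| ≤ 1 ∧ |p.2| ≤ 1 ∧ |p.1 + p.2| ≤ 1}

theorem abs_mul_add_mul_le_of_mem_hexagon {p : ℝ × ℝ} (hp : p ∈ hexagon) {a b c : ℝ} (ha : 0 ≤ a)
    (hb : 0 ≤ b) (hac : a ≤ c) (hbc : b ≤ c) : |a * p.1 + b * p.2| ≤ c := by
  obtain ⟨h1, h2, h12⟩ := hp
  rw [abs_le] at *
  rcases le_total a b <;> constructor <;> nlinarith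

theorem measurableSet_hexagon : MeasurableSet hexagon := by
  unfold hexagon
  measurability

theorem convex_setOf_abs_le {E : Type*} [AddCommGroup E] [Module ℝ E] (f : E →ₗ[ℝ] ℝ) (r : ℝ) :
    Convex ℝ {x | |f x| ≤ r} := by
  convert (convex_closedBall (0 : ℝ) r).linear_preimage f using 1
  ext
  simp

theorem convex_hexagon : Convex ℝ hexagon := by
  simp only [hexagon, ofPred_and]
  exact (convex_setOf_abs_le (LinearMap.fst ℝ ℝ ℝ) 1).inter <|
    (convex_setOf_abs_le (LinearMap.snd ℝ ℝ ℝ) 1).inter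
      (convex_setOf_abs_le (LinearMap.fst ℝ ℝ ℝ + LinearMap.snd ℝ ℝ ℝ) 1)

theorem neg_mem_hexagon {p : ℝ × ℝ} (hp : p ∈ hexagon) : -p ∈ hexagon := by
  simpa only [hexagon, mem_ofPred_eq, Prod.fst_neg, Prod.snd_neg, ← neg_add, abs_neg] using hp

theorem integral_two_sub_abs : ∫ u in (-1 : ℝ)..1, (2 - |u|) = 3 := by
  have hneg : ∫ u in (-1 : ℝ)..0, |u| = ∫ u in (-1 : ℝ)..0, -u :=
    intervalIntegral.integral_congr fun u hu =>
      abs_of_nonpos (uIcc_of_le (neg_one_lt_zero (R := ℝ)).le ▸ hu).2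
  have hpos : ∫ u in (0 : ℝ)..1, |u| = ∫ u in (0 : ℝ)..1, u :=
    intervalIntegral.integral_congr fun u hu =>
      abs_of_nonneg (uIcc_of_le (zero_le_one (α := ℝ)) ▸ hu).1
  rw [intervalIntegral.integral_sub intervalIntegrable_const
    (continuous_abs.intervalIntegrable _ _),
    ← intervalIntegral.integral_add_adjacent_intervals (b := 0)
      (continuous_abs.intervalIntegrable _ _) (continuous_abs.intervalIntegrable _ _),
    hneg, hpos, intervalIntegral.integral_neg, integral_id, integral_id,
    intervalIntegral.integral_const]
  norm_num

theorem three_le_volume_hexagon : ENNReal.ofReal 3 ≤ volume hexagon := by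
  set f : ℝ → ℝ := fun u => max (-1) (-1 - u)
  set g : ℝ → ℝ := fun u => min 1 (1 - u)
  have hsub : regionBetween f g (Ioc (-1) 1) ⊆ hexagon := by
    rintro ⟨u, v⟩ ⟨⟨hu1, hu2⟩, hv1, hv2⟩
    simp only [f, g, max_lt_iff, lt_min_iff] at hv1 hv2 hu1 hu2
    simp only [hexagon, mem_ofPred_eq, abs_le]
    refine ⟨⟨?_, ?_⟩, ⟨?_, ?_⟩, ?_, ?_⟩ <;> linarith
  have hlen (u : ℝ) : (g - f) u = 2 - |u| := by
    rcases le_total 0 u with hu | hu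
    · simp only [Pi.sub_apply, f, g, abs_of_nonneg hu]
      rw [min_eq_right (by linarith), max_eq_left (by linarith)]
      ring
    · simp only [Pi.sub_apply, f, g, abs_of_nonpos hu]
      rw [min_eq_left (by linarith), max_eq_right (by linarith)]
      ring
  have hfg : ∀ u ∈ Ioc (-1 : ℝ) 1, f u ≤ g u := fun u hu => by
    have : |u| ≤ 1 := abs_le.2 ⟨hu.1.le, hu.2⟩
    linarith [hlen u, Pi.sub_apply g f u]
  have hvol : volume (regionBetween f g (Ioc (-1) 1)) = ENNReal.ofReal 3 := by
    have hfc : Continuous f := by fun_prop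
    have hgc : Continuous g := by fun_prop
    rw [Measure.volume_eq_prod, volume_regionBetween_eq_integral hfc.integrableOn_Ioc
      hgc.integrableOn_Ioc measurableSet_Ioc hfg, funext hlen,
      ← intervalIntegral.integral_of_le (by norm_num), integral_two_sub_abs]
  exact hvol.ge.trans (measure_mono hsub)

/-- The right prism over `hexagon` whose axis is the `i`-th coordinate axis and whose height is
the open interval `(-1, 1)`; an integer in that interval vanishes. -/
def hexagonalPrism (i : Fin 3) : Set (Fin 3 → ℝ) :=
  {u | |u i| < 1 ∧ (u (i.succAbove 0), u (i.succAbove 1)) ∈ hexagon}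

theorem convex_hexagonalPrism (i : Fin 3) : Convex ℝ (hexagonalPrism i) := by
  let π (j : Fin 3) : (Fin 3 → ℝ) →ₗ[ℝ] ℝ := LinearMap.proj j
  have hprism : hexagonalPrism i =
      (π i).prod ((π (i.succAbove 0)).prod (π (i.succAbove 1))) ⁻¹' (Ioo (-1) 1 ×ˢ hexagon) := by
    ext u
    simp only [hexagonalPrism, mem_ofPred_eq, abs_lt]
    rfl
  rw [hprism]
  exact ((convex_Ioo (-1 : ℝ) 1).prod convex_hexagon).linear_preimage _

theorem neg_mem_hexagonalPrism {i : Fin 3} {u : Fin 3 → ℝ} (hu : u ∈ hexagonalPrism i) :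
    -u ∈ hexagonalPrism i :=
  ⟨by simpa only [Pi.neg_apply, abs_neg] using hu.1, neg_mem_hexagon hu.2⟩

theorem six_le_volume_hexagonalPrism (i : Fin 3) :
    ENNReal.ofReal 6 ≤ volume (hexagonalPrism i) := by
  have hsplit := ((MeasurePreserving.id (volume : Measure ℝ)).prod
    (volume_preserving_finTwoArrow ℝ)).comp (volume_preserving_piFinSuccAbove (fun _ => ℝ) i)
  have hprism : hexagonalPrism i = (Prod.map id (MeasurableEquiv.finTwoArrow (α := ℝ)) ∘
      MeasurableEquiv.piFinSuccAbove (fun _ => ℝ) i) ⁻¹' (Ioo (-1) 1 ×ˢ hexagon) := by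
    ext u
    simp only [hexagonalPrism, mem_ofPred_eq, abs_lt]
    rfl
  rw [hprism, hsplit.measure_preimage
    (measurableSet_Ioo.prod measurableSet_hexagon).nullMeasurableSet,
    Measure.prod_prod, Real.volume_Ioo]
  calc ENNReal.ofReal 6 = ENNReal.ofReal (1 - -1) * ENNReal.ofReal 3 := by
        rw [← ENNReal.ofReal_mul (by norm_num)]
        norm_num
    _ ≤ ENNReal.ofReal (1 - -1) * volume hexagon := by gcongr; exact three_le_volume_hexagon

section LatticePoint

variable {ι : Type*} [Fintype ι]

/-- The point with integer coordinates `z` in the lattice spanned by the columns of `M`. -/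
def latticePoint (M : Matrix ι ι ℝ) (z : ι → ℤ) : ι → ℝ :=
  M *ᵥ fun i => (z i : ℝ)

theorem latticePoint_zero (M : Matrix ι ι ℝ) : latticePoint M 0 = 0 := by
  simp only [latticePoint, Pi.zero_apply, Int.cast_zero]
  exact mulVec_zero M

variable [DecidableEq ι] {M : Matrix ι ι ℝ}

theorem latticePoint_ne_zero (hM : M.det ≠ 0) {z : ι → ℤ} (hz : z ≠ 0) : latticePoint M z ≠ 0 :=
  fun h => hz <| funext fun i => Int.cast_eq_zero.1 (congrFun (eq_zero_of_mulVec_eq_zero hM h) i)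

theorem finite_setOf_norm_latticePoint_le (hM : M.det ≠ 0) (r : ℝ) :
    {z : ι → ℤ | ‖latticePoint M z‖ ≤ r}.Finite := by
  obtain ⟨K, -, hK⟩ := (toLin' M).exists_antilipschitzWith <| LinearMap.ker_eq_bot'.2
    fun _ hx => eq_zero_of_mulVec_eq_zero hM hx
  have hbdd : Bornology.IsBounded (toLin' M ⁻¹' Metric.closedBall 0 r) :=
    hK.isBounded_preimage Metric.isBounded_closedBall
  have hcast : Function.Injective fun (z : ι → ℤ) i => (z i : ℝ) :=
    Int.cast_injective.comp_left
  refine ((ZSpan.setFinite_inter (Pi.basisFun ℝ ι) hbdd).preimage hcast.injOn).subset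
    fun z hz => ⟨by simpa [latticePoint] using hz, ?_⟩
  exact ((Pi.basisFun ℝ ι).mem_span_iff_repr_mem ℤ _).2 fun i => ⟨z i, by simp⟩

theorem exists_latticePoint_mem_of_volume_lt {s : Set (ι → ℝ)} (hM : M.det ≠ 0)
    (hneg : ∀ x ∈ s, -x ∈ s) (hconv : Convex ℝ s)
    (hs : ENNReal.ofReal (2 ^ Fintype.card ι * |M.det|) < volume s) :
    ∃ z : ι → ℤ, z ≠ 0 ∧ latticePoint M z ∈ s := by
  set b := Pi.basisFun ℝ ι
  set Λ := (Submodule.span ℤ (range b)).toAddSubgroup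
  have : Countable Λ := inferInstanceAs (Countable (Submodule.span ℤ (range b)))
  have hdet : LinearMap.det (toLin' M) ≠ 0 := by rwa [LinearMap.det_toLin']
  have hcovol : volume (ZSpan.fundamentalDomain b) = 1 := by
    rw [ZSpan.fundamentalDomain_pi_basisFun, volume_pi_pi]
    simp
  have hvol : volume (ZSpan.fundamentalDomain b) * 2 ^ Module.finrank ℝ (ι → ℝ) <
      volume (toLin' M ⁻¹' s) := by
    rw [Measure.addHaar_preimage_linearMap _ hdet, hcovol, LinearMap.det_toLin', one_mul,
      Module.finrank_fintype_fun_eq_card]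
    have hM' := ENNReal.ofReal_pos.2 (abs_pos.2 hM)
    rw [abs_inv, ENNReal.ofReal_inv_of_pos (abs_pos.2 hM), mul_comm, ← div_eq_mul_inv,
      ENNReal.lt_div_iff_mul_lt (.inl hM'.ne') (.inl ENNReal.ofReal_ne_top)]
    simpa [ENNReal.ofReal_mul, ENNReal.ofReal_pow] using hs
  obtain ⟨⟨x, hxΛ⟩, hx, hxs⟩ := exists_ne_zero_mem_lattice_of_measure_mul_two_pow_lt_measure
    (ZSpan.isAddFundamentalDomain' b volume)
    (fun x hx => by simpa only [mem_preimage, map_neg] using hneg _ hx)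
    (hconv.linear_preimage _) hvol
  obtain ⟨z, rfl⟩ : ∃ z : ι → ℤ, (fun i => (z i : ℝ)) = x := by
    choose z hz using (b.mem_span_iff_repr_mem ℤ x).1 hxΛ
    exact ⟨z, funext fun i => by simpa [b] using hz i⟩
  refine ⟨z, ?_, hxs⟩
  rintro rfl
  exact hx (Subtype.ext (by ext; simp))

end LatticePoint

theorem exists_minimal_of_finite_setOf_le {α β : Type*} [LinearOrder β] {S : Set α}
    (hS : S.Nonempty) (f : α → β) (hf : ∀ r, {x ∈ S | f x ≤ r}.Finite) :
    ∃ x ∈ S, ∀ y ∈ S, f x ≤ f y := by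
  obtain ⟨x₀, hx₀⟩ := hS
  obtain ⟨x, ⟨hxS, hx⟩, hmin⟩ := exists_min_image _ f (hf (f x₀)) ⟨x₀, hx₀, le_rfl⟩
  exact ⟨x, hxS, fun y hy => (le_total (f y) (f x₀)).elim (fun h => hmin y ⟨hy, h⟩) hx.trans⟩

theorem eq_zero_of_abs_intCast_lt_one {n : ℤ} (h : |(n : ℝ)| < 1) : n = 0 :=
  Int.abs_lt_one_iff.1 (by exact_mod_cast h)

theorem abs_le_one_of_dotProduct_eq_zero {ℓ v : Fin 3 → ℝ} (hℓ : 0 ≤ ℓ) {i : Fin 3}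
    (hi : 0 < ℓ i) (hmax : ∀ j, ℓ j ≤ ℓ i)
    (hv : (v (i.succAbove 0), v (i.succAbove 1)) ∈ hexagon) (h : ℓ ⬝ᵥ v = 0) : |v i| ≤ 1 := by
  have hsum : ℓ (i.succAbove 0) * v (i.succAbove 0) + ℓ (i.succAbove 1) * v (i.succAbove 1) =
      -(ℓ i * v i) := by
    rw [dotProduct, Fin.sum_univ_succAbove _ i, Fin.sum_univ_two] at h
    linear_combination h
  have hle := abs_mul_add_mul_le_of_mem_hexagon hv (hℓ (i.succAbove 0)) (hℓ (i.succAbove 1))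
    (hmax _) (hmax _)
  rw [hsum, abs_neg, abs_mul, abs_of_pos hi] at hle
  exact le_of_mul_le_mul_left (hle.trans_eq (mul_one _).symm) hi

theorem exists_norm_latticePoint_le_one_of_nonneg {B : Matrix (Fin 3) (Fin 3) ℝ} (hB : B.det ≠ 0)
    {ℓ : Fin 3 → ℝ} (hℓ : 0 ≤ ℓ) (hℓ0 : ℓ ≠ 0) {z : Fin 3 → ℤ}
    (hz : ℓ ᵥ* B = fun j => (z j : ℝ)) (h : 4 * ‖ℓ‖ * |B.det| < 3) :
    ∃ w : Fin 3 → ℤ, w ≠ 0 ∧ ‖latticePoint B w‖ ≤ 1 := by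
  obtain ⟨i, hmax⟩ := Finite.exists_max ℓ
  have hi : ‖ℓ‖ = ℓ i := by
    rw [← abs_of_nonneg (hℓ i)]
    refine ((pi_norm_le_iff_of_nonempty ℓ).2 fun j => ?_).antisymm (norm_le_pi_norm ℓ i)
    exact abs_le_abs_of_nonneg (hℓ j) (hmax j)
  have hi0 : 0 < ℓ i := hi ▸ norm_pos_iff.2 hℓ0
  -- `ℓB` is integral, so with it as row `i` the `i`-th coordinates of lattice points are integers:
  -- a lattice point in the prism lies in the plane `ℓ ⬝ᵥ v = 0`.
  let M : Matrix (Fin 3) (Fin 3) ℝ := B.updateRow i (ℓ ᵥ* B)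
  have hM : M.det = ℓ i * B.det := by
    simp only [M, vecMul_eq_sum]
    exact det_updateRow_sum B i ℓ
  have hvol : ENNReal.ofReal (2 ^ Fintype.card (Fin 3) * |M.det|) < volume (hexagonalPrism i) := by
    refine lt_of_lt_of_le ?_ (six_le_volume_hexagonalPrism i)
    rw [ENNReal.ofReal_lt_ofReal_iff (by norm_num), hM, abs_mul, abs_of_pos hi0, Fintype.card_fin]
    linarith [hi ▸ h]
  obtain ⟨w, hw0, hwi, hw⟩ := exists_latticePoint_mem_of_volume_lt
    (hM ▸ mul_ne_zero hi0.ne' hB) (fun _ => neg_mem_hexagonalPrism) (convex_hexagonalPrism i) hvol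
  have hne (k : Fin 2) :
      latticePoint M w (i.succAbove k) = latticePoint B w (i.succAbove k) := by
    simp [M, latticePoint, mulVec, Fin.succAbove_ne]
  have heq : latticePoint M w i = ((z ⬝ᵥ w : ℤ) : ℝ) := by
    simp [M, latticePoint, mulVec, hz, dotProduct]
  have hzw : z ⬝ᵥ w = 0 := eq_zero_of_abs_intCast_lt_one (heq ▸ hwi)
  rw [hne, hne] at hw
  refine ⟨w, hw0, (pi_norm_le_iff_of_nonempty _).2 ((Fin.forall_iff_succAbove i).2 ⟨?_, ?_⟩)⟩
  · refine abs_le_one_of_dotProduct_eq_zero hℓ hi0 hmax hw ?_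
    rw [latticePoint, dotProduct_mulVec, hz]
    simpa [dotProduct] using congrArg (Int.cast : ℤ → ℝ) hzw
  · rw [Fin.forall_fin_two]
    exact ⟨hw.1, hw.2.1⟩

theorem exists_norm_latticePoint_le_one_of_lt {B : Matrix (Fin 3) (Fin 3) ℝ} (hB : B.det ≠ 0)
    {ℓ : Fin 3 → ℝ} (hℓ : ℓ ≠ 0) {z : Fin 3 → ℤ} (hz : ℓ ᵥ* B = fun j => (z j : ℝ))
    (h : 4 * ‖ℓ‖ * |B.det| < 3) :
    ∃ w : Fin 3 → ℤ, w ≠ 0 ∧ ‖latticePoint B w‖ ≤ 1 := by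
  let σ (j : Fin 3) : ℝ := if ℓ j < 0 then -1 else 1
  have hσ (j : Fin 3) : |σ j| = 1 := by
    by_cases hj : ℓ j < 0 <;> simp [σ, hj]
  have hσℓ (j : Fin 3) : |ℓ j| * σ j = ℓ j := by
    by_cases hj : ℓ j < 0
    · simp [σ, hj, abs_of_neg]
    · simp [σ, hj, abs_of_nonneg (not_lt.1 hj)]
  have hdet : |(diagonal σ * B).det| = |B.det| := by
    rw [det_mul, det_diagonal, abs_mul, Finset.abs_prod, Finset.prod_congr rfl fun j _ => hσ j,
      Finset.prod_const_one, one_mul]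
  have hvec : (fun j => |ℓ j|) ᵥ* (diagonal σ * B) = fun j => (z j : ℝ) := by
    rw [← vecMul_vecMul, ← hz]
    congr 1
    ext j
    rw [vecMul_diagonal, hσℓ]
  have hnorm : ‖fun j => |ℓ j|‖ = ‖ℓ‖ := by
    simp [Pi.norm_def]
  obtain ⟨w, hw0, hw⟩ := exists_norm_latticePoint_le_one_of_nonneg
    (abs_pos.1 (hdet ▸ abs_pos.2 hB)) (fun j => abs_nonneg (ℓ j))
    (norm_ne_zero_iff.1 (hnorm ▸ norm_ne_zero_iff.2 hℓ)) hvec (by rwa [hnorm, hdet])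
  refine ⟨w, hw0, ?_⟩
  rw [pi_norm_le_iff_of_nonempty] at hw ⊢
  intro j
  have : latticePoint (diagonal σ * B) w j = σ j * latticePoint B w j := by
    rw [latticePoint, ← mulVec_mulVec, mulVec_diagonal, latticePoint]
  simpa [this, hσ] using hw j

theorem exists_norm_latticePoint_le_of_one_lt {B : Matrix (Fin 3) (Fin 3) ℝ} (hB : B.det ≠ 0)
    {ℓ : Fin 3 → ℝ} (hℓ : ℓ ≠ 0) {z : Fin 3 → ℤ} (hz : ℓ ᵥ* B = fun j => (z j : ℝ))
    (h : 4 * ‖ℓ‖ * |B.det| ≤ 3) {r : ℝ} (hr : 1 < r) :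
    ∃ w : Fin 3 → ℤ, w ≠ 0 ∧ ‖latticePoint B w‖ ≤ r := by
  have hr0 : 0 < r := one_pos.trans hr
  have hdet : (r⁻¹ • B).det = (r ^ 3)⁻¹ * B.det := by
    rw [det_smul, Fintype.card_fin, inv_pow]
  have hvec : (r • ℓ) ᵥ* (r⁻¹ • B) = fun j => (z j : ℝ) := by
    rw [smul_vecMul, vecMul_smul, smul_inv_smul₀ hr0.ne', hz]
  have hsmall : 4 * ‖r • ℓ‖ * |(r⁻¹ • B).det| < 3 := by
    have hscale : 4 * ‖r • ℓ‖ * |(r⁻¹ • B).det| = (r ^ 2)⁻¹ * (4 * ‖ℓ‖ * |B.det|) := by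
      rw [hdet, norm_smul, Real.norm_of_nonneg hr0.le, abs_mul,
        abs_of_pos (show 0 < (r ^ 3)⁻¹ by positivity)]
      field_simp
    rw [hscale, inv_mul_lt_iff₀ (by positivity)]
    nlinarith
  obtain ⟨w, hw0, hw⟩ := exists_norm_latticePoint_le_one_of_lt
    (hdet ▸ mul_ne_zero (by positivity) hB) (smul_ne_zero hr0.ne' hℓ) hvec hsmall
  refine ⟨w, hw0, ?_⟩
  rwa [latticePoint, smul_mulVec, norm_smul, norm_inv, Real.norm_of_nonneg hr0.le,
    inv_mul_le_iff₀ hr0, mul_one] at hw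

theorem exists_norm_latticePoint_le_one_of_le {B : Matrix (Fin 3) (Fin 3) ℝ} (hB : B.det ≠ 0)
    {ℓ : Fin 3 → ℝ} (hℓ : ℓ ≠ 0) {z : Fin 3 → ℤ} (hz : ℓ ᵥ* B = fun j => (z j : ℝ))
    (h : 4 * ‖ℓ‖ * |B.det| ≤ 3) :
    ∃ w : Fin 3 → ℤ, w ≠ 0 ∧ ‖latticePoint B w‖ ≤ 1 := by
  obtain ⟨w, hw0, hmin⟩ := exists_minimal_of_finite_setOf_le
    (S := {w : Fin 3 → ℤ | w ≠ 0}) ⟨1, one_ne_zero⟩ (‖latticePoint B ·‖)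
    fun r => (finite_setOf_norm_latticePoint_le hB r).subset fun _ hw => hw.2
  refine ⟨w, hw0, le_of_forall_gt_imp_ge_of_dense fun r hr => ?_⟩
  obtain ⟨w', hw'0, hw'⟩ := exists_norm_latticePoint_le_of_one_lt hB hℓ hz h hr
  exact (hmin w' hw'0).trans hw'

theorem norm_le_iff_head_tail {n : ℕ} {v : Fin (n + 2) → ℝ} {r : ℝ} :
    ‖v‖ ≤ r ↔ |v 0| ≤ r ∧ ‖Fin.tail v‖ ≤ r := by
  simp only [pi_norm_le_iff_of_nonempty, Real.norm_eq_abs]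
  exact Fin.forall_fin_succ

theorem norm_mul_le_iff_head_tail {Q U : ℝ} (hQ : 0 ≤ Q) (hU : 0 ≤ U) {v : Fin 3 → ℝ} {r : ℝ} :
    ‖![Q, U, U] * v‖ ≤ r ↔ Q * |v 0| ≤ r ∧ U * ‖Fin.tail v‖ ≤ r := by
  have htail : Fin.tail (![Q, U, U] * v) = U • Fin.tail v := by
    ext k
    fin_cases k <;> rfl
  rw [norm_le_iff_head_tail, htail, norm_smul, Real.norm_of_nonneg hU, Pi.mul_apply, cons_val_zero,
    abs_mul, abs_of_nonneg hQ]

section CrossProduct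

theorem transpose_mulVec_cross {R : Type*} [CommRing R] (A : Matrix (Fin 3) (Fin 3) R)
    (v w : Fin 3 → R) : Aᵀ *ᵥ ((A *ᵥ v) ⨯₃ (A *ᵥ w)) = A.det • (v ⨯₃ w) := by
  ext i
  fin_cases i <;>
    simp [cross_apply, mulVec, dotProduct, Fin.sum_univ_three, det_fin_three] <;> ring

variable {v w : Fin 3 → ℝ}

theorem abs_le_norm_tail (v : Fin 3 → ℝ) : |v 1| ≤ ‖Fin.tail v‖ ∧ |v 2| ≤ ‖Fin.tail v‖ :=
  ⟨norm_le_pi_norm (Fin.tail v) 0, norm_le_pi_norm (Fin.tail v) 1⟩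

theorem abs_cross_head_le (v w : Fin 3 → ℝ) :
    |(v ⨯₃ w) 0| ≤ 2 * ‖Fin.tail v‖ * ‖Fin.tail w‖ := by
  obtain ⟨hv1, hv2⟩ := abs_le_norm_tail v
  obtain ⟨hw1, hw2⟩ := abs_le_norm_tail w
  calc |(v ⨯₃ w) 0| ≤ |v 1| * |w 2| + |v 2| * |w 1| := by
        rw [← abs_mul, ← abs_mul]
        exact abs_sub (v 1 * w 2) (v 2 * w 1)
    _ ≤ ‖Fin.tail v‖ * ‖Fin.tail w‖ + ‖Fin.tail v‖ * ‖Fin.tail w‖ := by gcongr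
    _ = 2 * ‖Fin.tail v‖ * ‖Fin.tail w‖ := by ring

theorem norm_tail_cross_le (v w : Fin 3 → ℝ) :
    ‖Fin.tail (v ⨯₃ w)‖ ≤ |v 0| * ‖Fin.tail w‖ + |w 0| * ‖Fin.tail v‖ := by
  obtain ⟨hv1, hv2⟩ := abs_le_norm_tail v
  obtain ⟨hw1, hw2⟩ := abs_le_norm_tail w
  rw [pi_norm_le_iff_of_nonempty, Fin.forall_fin_two]
  constructor
  · calc |v 2 * w 0 - v 0 * w 2| ≤ |v 0| * |w 2| + |w 0| * |v 2| := by
          rw [abs_sub_comm, mul_comm (v 2), ← abs_mul, ← abs_mul]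
          exact abs_sub _ _
      _ ≤ |v 0| * ‖Fin.tail w‖ + |w 0| * ‖Fin.tail v‖ := by gcongr
  · calc |v 0 * w 1 - v 1 * w 0| ≤ |v 0| * |w 1| + |w 0| * |v 1| := by
          rw [mul_comm (v 1), ← abs_mul, ← abs_mul]
          exact abs_sub _ _
      _ ≤ |v 0| * ‖Fin.tail w‖ + |w 0| * ‖Fin.tail v‖ := by gcongr

theorem cross_ne_zero_of_lt (h : |w 0| * ‖Fin.tail v‖ < |v 0| * ‖Fin.tail w‖) : v ⨯₃ w ≠ 0 := by
  intro h0
  have hprop : v 0 • Fin.tail w = w 0 • Fin.tail v := by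
    ext k
    have h1 := congrFun h0 1
    have h2 := congrFun h0 2
    fin_cases k <;> simp [cross_apply, Fin.tail] at h1 h2 ⊢ <;> linarith
  refine h.ne' ?_
  rw [← Real.norm_eq_abs, ← Real.norm_eq_abs, ← norm_smul, ← norm_smul, hprop]

end CrossProduct

section Transference

variable {A B : Matrix (Fin 3) (Fin 3) ℝ}

theorem cross_latticePoint (hA : A.det = 1) (hAB : Aᵀ * B = 1) (u u' : Fin 3 → ℤ) :
    latticePoint A u ⨯₃ latticePoint A u' = latticePoint B (u ⨯₃ u') := by
  have hBA : B * Aᵀ = 1 := mul_eq_one_comm.1 hAB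
  have hcast : (fun i => ((u ⨯₃ u') i : ℝ)) = (fun i => (u i : ℝ)) ⨯₃ (fun i => (u' i : ℝ)) := by
    ext i
    fin_cases i <;> simp [cross_apply]
  have hcross := transpose_mulVec_cross A (fun i => (u i : ℝ)) (fun i => (u' i : ℝ))
  rw [hA, one_smul, ← hcast] at hcross
  rw [latticePoint, latticePoint, latticePoint, ← hcross, mulVec_mulVec, hBA, one_mulVec]

theorem latticePoint_vecMul (hAB : Aᵀ * B = 1) (u : Fin 3 → ℤ) :
    latticePoint A u ᵥ* B = fun j => (u j : ℝ) := by
  rw [latticePoint, ← vecMul_transpose, vecMul_vecMul, hAB, vecMul_one]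

theorem exists_latticePoint_mem_box (hA : A.det = 1) (hAB : Aᵀ * B = 1) {u : Fin 3 → ℤ}
    (hu : u ≠ 0) {Q U : ℝ} (hQ : 0 < Q) (hU : 0 < U)
    (hhead : |latticePoint A u 0| * Q ≤ ‖Fin.tail (latticePoint A u)‖ * U)
    (htail : 4 * ‖Fin.tail (latticePoint A u)‖ ≤ 3 * (Q * U)) :
    ∃ w : Fin 3 → ℤ, w ≠ 0 ∧ |latticePoint B w 0| ≤ Q ∧ ‖Fin.tail (latticePoint B w)‖ ≤ U := by
  have hB : B.det = 1 := by
    simpa [det_mul, hA] using congrArg det hAB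
  set ℓ := latticePoint A u
  set D : Matrix (Fin 3) (Fin 3) ℝ := diagonal ![Q⁻¹, U⁻¹, U⁻¹]
  have hdet : (D * B).det = (Q * U * U)⁻¹ := by
    simp [D, hB, Fin.prod_univ_three, mul_comm, mul_left_comm]
  have hD : (![Q, U, U] * ℓ) ᵥ* D = ℓ := by
    ext j
    rw [vecMul_diagonal]
    fin_cases j <;> simp [mul_right_comm, hQ.ne', hU.ne']
  have hvec : (![Q, U, U] * ℓ) ᵥ* (D * B) = fun j => (u j : ℝ) := by
    rw [← vecMul_vecMul, hD, latticePoint_vecMul hAB]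
  have hℓ0 : ![Q, U, U] * ℓ ≠ 0 := fun h =>
    latticePoint_ne_zero (hA ▸ one_ne_zero) hu (hD.symm.trans (by rw [h, zero_vecMul]))
  have hnorm : ‖![Q, U, U] * ℓ‖ ≤ U * ‖Fin.tail ℓ‖ :=
    (norm_mul_le_iff_head_tail hQ.le hU.le).2 ⟨by linarith, le_rfl⟩
  have hsmall : 4 * ‖![Q, U, U] * ℓ‖ * |(D * B).det| ≤ 3 := by
    rw [hdet, abs_of_pos (by positivity), ← div_eq_mul_inv, div_le_iff₀ (by positivity)]
    nlinarith
  obtain ⟨w, hw0, hw⟩ := exists_norm_latticePoint_le_one_of_le (hdet ▸ by positivity) hℓ0 hvec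
    hsmall
  have hpoint : latticePoint (D * B) w = ![Q⁻¹, U⁻¹, U⁻¹] * latticePoint B w := by
    ext j
    rw [latticePoint, ← mulVec_mulVec, mulVec_diagonal, latticePoint, Pi.mul_apply]
  rw [hpoint, norm_mul_le_iff_head_tail (by positivity) (by positivity), inv_mul_le_iff₀ hQ,
    inv_mul_le_iff₀ hU, mul_one, mul_one] at hw
  exact ⟨w, hw0, hw⟩

theorem finite_setOf_head_tail_le {M : Matrix (Fin 3) (Fin 3) ℝ} (hM : M.det ≠ 0) (r s : ℝ) :
    {z : Fin 3 → ℤ |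
      |latticePoint M z 0| ≤ r ∧ ‖Fin.tail (latticePoint M z)‖ ≤ s}.Finite :=
  (finite_setOf_norm_latticePoint_le hM (max r s)).subset fun _ hz =>
    norm_le_iff_head_tail.2 ⟨le_max_of_le_left hz.1, le_max_of_le_right hz.2⟩

theorem exists_minimal_tail (hA : A.det ≠ 0) {s κ L : ℝ} (hs : 0 < s) (hL : 0 < L)
    (hmin : ∀ z : Fin 3 → ℤ, z ≠ 0 → ‖Fin.tail (latticePoint A z)‖ ≤ s →
      L ≤ |latticePoint A z 0|)
    (H : ∀ t ≥ s, ∃ z : Fin 3 → ℤ, z ≠ 0 ∧ ‖Fin.tail (latticePoint A z)‖ ≤ t ∧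
      |latticePoint A z 0| * t ≤ κ) :
    ∃ u : Fin 3 → ℤ, |latticePoint A u 0| < L ∧ s < ‖Fin.tail (latticePoint A u)‖ ∧
      L * ‖Fin.tail (latticePoint A u)‖ ≤ κ := by
  have hshort (t : ℝ) (ht : max s (κ / L) < t) : ∃ z : Fin 3 → ℤ,
      (z ≠ 0 ∧ |latticePoint A z 0| < L) ∧ ‖Fin.tail (latticePoint A z)‖ ≤ t := by
    obtain ⟨hst, hκt⟩ := max_lt_iff.1 ht
    obtain ⟨z, hz0, hztail, hzhead⟩ := H t hst.le
    have hlt : |latticePoint A z 0| * t < L * t := hzhead.trans_lt ((div_lt_iff₀' hL).1 hκt)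
    exact ⟨z, ⟨hz0, lt_of_mul_lt_mul_right hlt (hs.trans hst).le⟩, hztail⟩
  obtain ⟨t₀, ht₀⟩ := exists_gt (max s (κ / L))
  obtain ⟨z₀, hz₀, -⟩ := hshort t₀ ht₀
  obtain ⟨u, ⟨hu0, hu⟩, humin⟩ := exists_minimal_of_finite_setOf_le
    (S := {z : Fin 3 → ℤ | z ≠ 0 ∧ |latticePoint A z 0| < L}) ⟨z₀, hz₀⟩
    (fun z => ‖Fin.tail (latticePoint A z)‖)
    fun r => (finite_setOf_head_tail_le hA L r).subset fun _ hz => ⟨hz.1.2.le, hz.2⟩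
  have hsu : s < ‖Fin.tail (latticePoint A u)‖ := lt_of_not_ge fun h => hu.not_ge (hmin u hu0 h)
  refine ⟨u, hu, hsu, le_of_not_gt fun hκ => ?_⟩
  obtain ⟨t, ht, htu⟩ := exists_between (max_lt hsu ((div_lt_iff₀' hL).2 hκ))
  obtain ⟨z, hz, hzt⟩ := hshort t ht
  exact ((humin z hz).trans hzt).not_gt htu

theorem exists_latticePoint_mem_box_of_lt (hA : A.det = 1) (hAB : Aᵀ * B = 1) {c κ : ℝ}
    (hc : 0 < c) (hκ : 0 < κ) {u u' : Fin 3 → ℤ}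
    (hu : 3 * c * ‖Fin.tail (latticePoint A u)‖ * κ < |latticePoint A u 0|)
    (hhead : |latticePoint A u' 0| < |latticePoint A u 0|)
    (htail : ‖Fin.tail (latticePoint A u)‖ < ‖Fin.tail (latticePoint A u')‖)
    (hκu : |latticePoint A u 0| * ‖Fin.tail (latticePoint A u')‖ ≤ κ) :
    ∃ w : Fin 3 → ℤ, w ≠ 0 ∧ |latticePoint B w 0| ≤ 2 / (3 * c) ∧
      ‖Fin.tail (latticePoint B w)‖ ≤ 2 * κ := by
  have hcross := cross_latticePoint hA hAB u u'
  set v := latticePoint A u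
  set v' := latticePoint A u'
  have hprod : 3 * c * ‖Fin.tail v‖ * ‖Fin.tail v'‖ ≤ 1 := by
    refine le_of_mul_le_mul_right ?_ hκ
    calc 3 * c * ‖Fin.tail v‖ * ‖Fin.tail v'‖ * κ
      _ = 3 * c * ‖Fin.tail v‖ * κ * ‖Fin.tail v'‖ := by ring
      _ ≤ |v 0| * ‖Fin.tail v'‖ := by gcongr
      _ ≤ 1 * κ := hκu.trans_eq (one_mul _).symm
  have hlt : |v' 0| * ‖Fin.tail v‖ < |v 0| * ‖Fin.tail v'‖ :=
    mul_lt_mul' hhead.le htail (norm_nonneg _) ((abs_nonneg _).trans_lt hhead)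
  refine ⟨u ⨯₃ u', fun h => ?_, ?_, ?_⟩
  · exact cross_ne_zero_of_lt hlt (by rw [hcross, h, latticePoint_zero])
  · rw [← hcross, le_div_iff₀ (by positivity)]
    calc |(v ⨯₃ v') 0| * (3 * c) ≤ 2 * ‖Fin.tail v‖ * ‖Fin.tail v'‖ * (3 * c) := by
          gcongr
          exact abs_cross_head_le v v'
      _ ≤ 2 := by linarith
  · rw [← hcross]
    linarith [norm_tail_cross_le v v']

theorem exists_latticePoint_mem_dual_box (hA : A.det = 1) (hAB : Aᵀ * B = 1) {s c : ℝ}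
    (hs : 0 < s) (hc : 0 < c)
    (H : ∀ t ≥ s, ∃ z : Fin 3 → ℤ, z ≠ 0 ∧ ‖Fin.tail (latticePoint A z)‖ ≤ t ∧
      |latticePoint A z 0| * t ≤ s * c) :
    ∃ w : Fin 3 → ℤ, w ≠ 0 ∧ |latticePoint B w 0| ≤ 2 / (3 * c) ∧
      ‖Fin.tail (latticePoint B w)‖ ≤ 2 * (s * c) := by
  have hA0 : A.det ≠ 0 := hA ▸ one_ne_zero
  obtain ⟨z, hz0, hztail, -⟩ := H s le_rfl
  obtain ⟨u, ⟨hu0, hutail⟩, hmin⟩ := exists_minimal_of_finite_setOf_le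
    (S := {z : Fin 3 → ℤ | z ≠ 0 ∧ ‖Fin.tail (latticePoint A z)‖ ≤ s}) ⟨z, hz0, hztail⟩
    (fun z => |latticePoint A z 0|)
    fun r => (finite_setOf_head_tail_le hA0 r s).subset fun _ hz => ⟨hz.2, hz.1.2⟩
  set v := latticePoint A u
  rcases le_or_gt (|v 0| * (2 / (3 * c))) (‖Fin.tail v‖ * (2 * (s * c))) with hslice | hslice
  · refine exists_latticePoint_mem_box hA hAB hu0 (by positivity) (by positivity) hslice ?_
    calc 4 * ‖Fin.tail v‖ ≤ 4 * s := by gcongr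
      _ = 3 * (2 / (3 * c) * (2 * (s * c))) := by field_simp; norm_num
  · have hu : 3 * c * ‖Fin.tail v‖ * (s * c) < |v 0| := by
      rw [mul_div_assoc', lt_div_iff₀ (by positivity)] at hslice
      linarith
    obtain ⟨u', hhead, htail, hκu⟩ := exists_minimal_tail hA0 hs
      (lt_of_le_of_lt (by positivity) hu) (fun z hz0 hz => hmin z ⟨hz0, hz⟩) H
    exact exists_latticePoint_mem_box_of_lt hA hAB hc (mul_pos hs hc) hu hhead
      (hutail.trans_lt htail) hκu

end Transference

section Forms

/-- The columns span the lattice of points `(y - Θ x, x₁, x₂)` with `x₁`, `x₂`, `y` integers. -/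
def formMatrix (Θ : Matrix (Fin 1) (Fin 2) ℝ) : Matrix (Fin 3) (Fin 3) ℝ :=
  !![-Θ 0 0, -Θ 0 1, 1; 1, 0, 0; 0, 1, 0]

/-- The columns span the lattice of points `(q, Θ₁ q - p₁, Θ₂ q - p₂)` with `q`, `p₁`, `p₂`
integers, for the basis dual to the one in `formMatrix`. -/
def dualFormMatrix (Θ : Matrix (Fin 1) (Fin 2) ℝ) : Matrix (Fin 3) (Fin 3) ℝ :=
  !![0, 0, 1; 1, 0, Θ 0 0; 0, 1, Θ 0 1]

theorem ne_zero_of_norm_tail_pos {M : Matrix (Fin 3) (Fin 3) ℝ} {z : Fin 3 → ℤ}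
    (h : 0 < ‖Fin.tail (latticePoint M z)‖) : z ≠ 0 := by
  rintro rfl
  rw [latticePoint_zero] at h
  exact h.ne' norm_zero

theorem ne_zero_of_abs_head_pos {M : Matrix (Fin 3) (Fin 3) ℝ} {z : Fin 3 → ℤ}
    (h : 0 < |latticePoint M z 0|) : z ≠ 0 := by
  rintro rfl
  rw [latticePoint_zero] at h
  exact h.ne' abs_zero

variable (Θ : Matrix (Fin 1) (Fin 2) ℝ)

theorem det_formMatrix : (formMatrix Θ).det = 1 := by
  simp [formMatrix, det_fin_three]

theorem det_dualFormMatrix : (dualFormMatrix Θ).det = 1 := by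
  simp [dualFormMatrix, det_fin_three]

theorem transpose_formMatrix_mul_dualFormMatrix : (formMatrix Θ)ᵀ * dualFormMatrix Θ = 1 := by
  ext i j
  fin_cases i <;> fin_cases j <;> simp [formMatrix, dualFormMatrix, mul_apply, Fin.sum_univ_three]

theorem transpose_dualFormMatrix_mul_formMatrix : (dualFormMatrix Θ)ᵀ * formMatrix Θ = 1 := by
  simpa using congrArg transpose (transpose_formMatrix_mul_dualFormMatrix Θ)

theorem latticePoint_formMatrix (z : Fin 3 → ℤ) :
    latticePoint (formMatrix Θ) z = ![z 2 - Θ 0 0 * z 0 - Θ 0 1 * z 1, z 0, z 1] := by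
  ext i
  fin_cases i <;> simp [formMatrix, latticePoint, mulVec, dotProduct, Fin.sum_univ_three]
  ring

theorem latticePoint_dualFormMatrix (w : Fin 3 → ℤ) :
    latticePoint (dualFormMatrix Θ) w = ![(w 2 : ℝ), w 0 + Θ 0 0 * w 2, w 1 + Θ 0 1 * w 2] := by
  ext i
  fin_cases i <;> simp [dualFormMatrix, latticePoint, mulVec, dotProduct, Fin.sum_univ_three]

variable {Θ}

theorem uniformlyApproximable_iff {φ : ℝ → ℝ} : UniformlyApproximable Θ φ ↔
    ∀ᶠ t in atTop, ∃ z : Fin 3 → ℤ, 0 < ‖Fin.tail (latticePoint (formMatrix Θ) z)‖ ∧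
      ‖Fin.tail (latticePoint (formMatrix Θ) z)‖ ≤ t ∧ |latticePoint (formMatrix Θ) z 0| ≤ φ t := by
  have htail (x : Fin 2 → ℤ) (y : Fin 1 → ℤ) :
      Fin.tail (latticePoint (formMatrix Θ) ![x 0, x 1, y 0]) = fun j => (x j : ℝ) := by
    rw [latticePoint_formMatrix]
    ext k
    fin_cases k <;> rfl
  have hhead (x : Fin 2 → ℤ) (y : Fin 1 → ℤ) :
      |latticePoint (formMatrix Θ) ![x 0, x 1, y 0] 0| =
        ‖Θ *ᵥ (fun j => (x j : ℝ)) - fun i => (y i : ℝ)‖ := by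
    simp [latticePoint_formMatrix, Pi.norm_def, mulVec, dotProduct, abs_sub_comm, sub_sub]
  refine eventually_congr (.of_forall fun t => ⟨?_, ?_⟩)
  · rintro ⟨x, y, h⟩
    exact ⟨![x 0, x 1, y 0], by rwa [htail, hhead]⟩
  · rintro ⟨z, h⟩
    obtain ⟨x, y, rfl⟩ : ∃ (x : Fin 2 → ℤ) (y : Fin 1 → ℤ), z = ![x 0, x 1, y 0] :=
      ⟨![z 0, z 1], ![z 2], by ext i; fin_cases i <;> rfl⟩
    exact ⟨x, y, by rwa [← hhead, ← htail x y]⟩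

theorem uniformlyApproximable_transpose_iff {φ : ℝ → ℝ} : UniformlyApproximable Θᵀ φ ↔
    ∀ᶠ t in atTop, ∃ w : Fin 3 → ℤ, 0 < |latticePoint (dualFormMatrix Θ) w 0| ∧
      |latticePoint (dualFormMatrix Θ) w 0| ≤ t ∧
        ‖Fin.tail (latticePoint (dualFormMatrix Θ) w)‖ ≤ φ t := by
  have hhead (q : Fin 1 → ℤ) (p : Fin 2 → ℤ) :
      |latticePoint (dualFormMatrix Θ) ![-p 0, -p 1, q 0] 0| = ‖fun j => (q j : ℝ)‖ := by
    simp [latticePoint_dualFormMatrix, Pi.norm_def]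
  have htail (q : Fin 1 → ℤ) (p : Fin 2 → ℤ) :
      Fin.tail (latticePoint (dualFormMatrix Θ) ![-p 0, -p 1, q 0]) =
        Θᵀ *ᵥ (fun j => (q j : ℝ)) - fun i => (p i : ℝ) := by
    rw [latticePoint_dualFormMatrix]
    ext k
    fin_cases k <;> simp [Fin.tail, mulVec, dotProduct, neg_add_eq_sub]
  refine eventually_congr (.of_forall fun t => ⟨?_, ?_⟩)
  · rintro ⟨q, p, h⟩
    exact ⟨![-p 0, -p 1, q 0], by rwa [htail, hhead]⟩
  · rintro ⟨w, h⟩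
    obtain ⟨q, p, rfl⟩ : ∃ (q : Fin 1 → ℤ) (p : Fin 2 → ℤ), w = ![-p 0, -p 1, q 0] :=
      ⟨![w 2], ![-w 0, -w 1], by ext i; fin_cases i <;> simp⟩
    exact ⟨q, p, by rwa [← hhead q p, ← htail]⟩

theorem norm_tail_latticePoint_formMatrix_pos {z : Fin 3 → ℤ} (hz : z ≠ 0)
    (h : |latticePoint (formMatrix Θ) z 0| < 1) :
    0 < ‖Fin.tail (latticePoint (formMatrix Θ) z)‖ := by
  refine norm_pos_iff.2 fun htail => hz ?_
  rw [latticePoint_formMatrix] at h htail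
  have h0 : z 0 = 0 := Int.cast_eq_zero.1 (congrFun htail 0)
  have h1 : z 1 = 0 := Int.cast_eq_zero.1 (congrFun htail 1)
  have h2 : z 2 = 0 := eq_zero_of_abs_intCast_lt_one (by simpa [h0, h1] using h)
  ext i
  fin_cases i <;> assumption

theorem abs_latticePoint_dualFormMatrix_pos {w : Fin 3 → ℤ} (hw : w ≠ 0)
    (h : ‖Fin.tail (latticePoint (dualFormMatrix Θ) w)‖ < 1) :
    0 < |latticePoint (dualFormMatrix Θ) w 0| := by
  refine abs_pos.2 fun hhead => hw ?_
  have htail := abs_le_norm_tail (latticePoint (dualFormMatrix Θ) w)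
  rw [latticePoint_dualFormMatrix] at h hhead htail
  have h2 : w 2 = 0 := Int.cast_eq_zero.1 hhead
  have h0 : w 0 = 0 := eq_zero_of_abs_intCast_lt_one
    (by simpa [h2] using htail.1.trans_lt h)
  have h1 : w 1 = 0 := eq_zero_of_abs_intCast_lt_one
    (by simpa [h2] using htail.2.trans_lt h)
  ext i
  fin_cases i <;> assumption

end Forms

section PosInvertible

variable {g : ℝ → ℝ}

theorem PosInvertible.pos (hg : PosInvertible g) {t : ℝ} (ht : 0 < t) : 0 < g t :=
  hg.mapsTo ht

theorem PosInvertible.tendsto_zero_of_antitoneOn (hg : PosInvertible g)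
    (hanti : AntitoneOn g (Ioi 0)) : Tendsto g atTop (𝓝 0) := by
  refine tendsto_order.2 ⟨fun r hr => ?_, fun r hr => ?_⟩
  · filter_upwards [eventually_gt_atTop 0] with t ht using hr.trans (hg.pos ht)
  · obtain ⟨x, hx, hgx⟩ := hg.surjOn (half_pos hr)
    filter_upwards [eventually_ge_atTop x] with t ht
    calc g t ≤ g x := hanti hx (lt_of_lt_of_le hx ht) ht
      _ < r := hgx ▸ half_lt_self hr

theorem PosInvertible.tendsto_posInv_atTop (hg : PosInvertible g)
    (hmono : MonotoneOn g (Ioi 0)) : Tendsto (posInv g) atTop atTop := by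
  refine tendsto_atTop.2 fun r => ?_
  have hr : 0 < max r 1 := lt_max_of_lt_right one_pos
  filter_upwards [eventually_gt_atTop (g (max r 1)), eventually_gt_atTop 0] with t ht ht0
  obtain ⟨hpos, hspec, -⟩ := posInv_spec hg ht0
  by_contra! hlt
  exact (hmono hpos hr (hlt.le.trans (le_max_left r 1))).not_gt (hspec.symm ▸ ht)

theorem PosInvertible.tendsto_posInv_nhdsGT_zero (hg : PosInvertible g)
    (hanti : AntitoneOn g (Ioi 0)) : Tendsto (posInv g) (𝓝[>] 0) atTop := by
  refine tendsto_atTop.2 fun r => ?_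
  have hr : 0 < max r 1 := lt_max_of_lt_right one_pos
  filter_upwards [Ioo_mem_nhdsGT (hg.pos hr)] with t ⟨ht0, ht⟩
  obtain ⟨hpos, hspec, -⟩ := posInv_spec hg ht0
  by_contra! hlt
  exact (hanti hpos hr (hlt.le.trans (le_max_left r 1))).not_gt (hspec.symm ▸ ht)

theorem PosInvertible.antitoneOn_posInv (hg : PosInvertible g) (hanti : AntitoneOn g (Ioi 0)) :
    AntitoneOn (posInv g) (Ioi 0) := by
  intro a ha b hb hab
  obtain ⟨hpos_a, hspec_a, -⟩ := posInv_spec hg ha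
  obtain ⟨hpos_b, hspec_b, -⟩ := posInv_spec hg hb
  exact ((hanti.strictAntiOn_of_injOn hg.injOn).le_iff_ge hpos_a hpos_b).1
    (by rwa [hspec_a, hspec_b])

end PosInvertible

section Main

variable {Θ : Matrix (Fin 1) (Fin 2) ℝ} {ψ : ℝ → ℝ}

theorem exists_dualFormMatrix_of_antitoneOn (hf : AntitoneOn (fun t => t * ψ t) (Ioi 0)) {s : ℝ}
    (hs : 0 < s) (hψs : 0 < ψ s)
    (H : ∀ t ≥ s, ∃ z : Fin 3 → ℤ, z ≠ 0 ∧ ‖Fin.tail (latticePoint (formMatrix Θ) z)‖ ≤ t ∧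
      |latticePoint (formMatrix Θ) z 0| ≤ ψ t) :
    ∃ w : Fin 3 → ℤ, w ≠ 0 ∧ |latticePoint (dualFormMatrix Θ) w 0| ≤ 2 / (3 * ψ s) ∧
      ‖Fin.tail (latticePoint (dualFormMatrix Θ) w)‖ ≤ 2 * (s * ψ s) := by
  refine exists_latticePoint_mem_dual_box (det_formMatrix Θ)
    (transpose_formMatrix_mul_dualFormMatrix Θ) hs hψs fun t hst => ?_
  obtain ⟨z, hz0, htail, hhead⟩ := H t hst
  have ht : 0 < t := hs.trans_le hst
  refine ⟨z, hz0, htail, ?_⟩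
  calc |latticePoint (formMatrix Θ) z 0| * t ≤ ψ t * t := by gcongr
    _ = t * ψ t := mul_comm _ _
    _ ≤ s * ψ s := hf hs ht hst

theorem exists_formMatrix_of_monotoneOn (hψ : PosInvertible ψ) (hψ_dec : AntitoneOn ψ (Ioi 0))
    (hf : MonotoneOn (fun t => t * ψ t) (Ioi 0)) {T s : ℝ} (hT : 0 < T) (hTs : T ≤ s)
    (hTf : T ≤ s * ψ s)
    (H : ∀ t ≥ T, ∃ w : Fin 3 → ℤ, w ≠ 0 ∧ |latticePoint (dualFormMatrix Θ) w 0| ≤ t ∧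
      ‖Fin.tail (latticePoint (dualFormMatrix Θ) w)‖ ≤ ψ t) :
    ∃ z : Fin 3 → ℤ, z ≠ 0 ∧ |latticePoint (formMatrix Θ) z 0| ≤ 2 / (3 * s) ∧
      ‖Fin.tail (latticePoint (formMatrix Θ) z)‖ ≤ 2 * (s * ψ s) := by
  have hs : 0 < s := hT.trans_le hTs
  have hψs : 0 < ψ s := hψ.pos hs
  rw [mul_comm s]
  refine exists_latticePoint_mem_dual_box (det_dualFormMatrix Θ)
    (transpose_dualFormMatrix_mul_formMatrix Θ) hψs hs fun t hst => ?_
  have ht : 0 < t := hψs.trans_le hst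
  rcases le_or_gt 1 t with ht1 | ht1
  · refine ⟨![1, 0, 0], by simp, ?_, ?_⟩ <;> rw [latticePoint_dualFormMatrix]
    · refine (pi_norm_le_iff_of_nonempty _).2 (Fin.forall_fin_two.2 ⟨?_, ?_⟩) <;>
        simp [Fin.tail, ht1, ht.le]
    · simpa using (mul_pos hψs hs).le
  rcases le_total (ψ T) t with hTt | hTt
  · obtain ⟨w, hw0, hhead, htail⟩ := H T le_rfl
    refine ⟨w, hw0, htail.trans hTt, ?_⟩
    calc |latticePoint (dualFormMatrix Θ) w 0| * t ≤ T * 1 := by gcongr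
      _ ≤ ψ s * s := by linarith
  · obtain ⟨hr, hψr, -⟩ := posInv_spec hψ ht
    set r := posInv ψ t
    have hψ_strict : StrictAntiOn ψ (Ioi 0) := hψ_dec.strictAntiOn_of_injOn hψ.injOn
    have hTr : T ≤ r := (hψ_strict.le_iff_ge hr hT).1 (hψr.symm ▸ hTt)
    have hrs : r ≤ s := (hψ_strict.le_iff_ge hs hr).1 (hψr.symm ▸ hst)
    obtain ⟨w, hw0, hhead, htail⟩ := H r hTr
    refine ⟨w, hw0, hψr ▸ htail, ?_⟩
    calc |latticePoint (dualFormMatrix Θ) w 0| * t ≤ r * ψ r := by rw [hψr]; gcongr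
      _ ≤ s * ψ s := hf hr hs hrs
      _ = ψ s * s := mul_comm _ _

theorem tendsto_two_div_three_mul : Tendsto (fun t : ℝ => 2 / (3 * t)) atTop (𝓝[>] 0) := by
  refine tendsto_nhdsWithin_iff.2 ⟨?_, ?_⟩
  · exact tendsto_const_nhds.div_atTop (tendsto_id.const_mul_atTop three_pos)
  · filter_upwards [eventually_gt_atTop 0] with t ht
    exact mem_Ioi.2 (by positivity)

theorem UniformlyApproximable.transpose_of_antitoneOn (hψ : PosInvertible ψ)
    (hψ_dec : AntitoneOn ψ (Ioi 0)) (hf : PosInvertible fun t => t * ψ t)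
    (hf_dec : AntitoneOn (fun t => t * ψ t) (Ioi 0)) (h : UniformlyApproximable Θ ψ) :
    UniformlyApproximable Θᵀ fun t => 4 / (3 * t) * posInv ψ (2 / (3 * t)) := by
  have hs := (hψ.tendsto_posInv_nhdsGT_zero hψ_dec).comp tendsto_two_div_three_mul
  have hsmall := (hf.tendsto_zero_of_antitoneOn hf_dec).eventually_lt_const one_half_pos
  rw [uniformlyApproximable_transpose_iff]
  filter_upwards [eventually_gt_atTop 0, hs.eventually hsmall,
    hs.eventually (eventually_forall_ge_atTop.2 (uniformlyApproximable_iff.1 h))] with t ht hlt H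
  obtain ⟨hs0, hψs, -⟩ := posInv_spec hψ (show 0 < 2 / (3 * t) by positivity)
  simp only [Function.comp_apply] at hlt H
  set s := posInv ψ (2 / (3 * t))
  obtain ⟨w, hw0, hhead, htail⟩ := exists_dualFormMatrix_of_antitoneOn hf_dec hs0 (hψ.pos hs0)
    fun t' ht' => (H t' ht').imp fun z hz => ⟨ne_zero_of_norm_tail_pos hz.1, hz.2⟩
  refine ⟨w, abs_latticePoint_dualFormMatrix_pos hw0 (by linarith), ?_, ?_⟩
  · rw [hψs] at hhead
    refine hhead.trans_eq ?_
    field_simp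
  · rw [hψs] at htail
    refine htail.trans_eq ?_
    ring

theorem UniformlyApproximable.of_transpose_of_monotoneOn (hψ : PosInvertible ψ)
    (hψ_dec : AntitoneOn ψ (Ioi 0)) (hf : PosInvertible fun t => t * ψ t)
    (hf_inc : MonotoneOn (fun t => t * ψ t) (Ioi 0)) (h : UniformlyApproximable Θᵀ ψ) :
    UniformlyApproximable Θ fun t => 2 / (3 * posInv (fun s => s * ψ s) (t / 2)) := by
  obtain ⟨T₀, hT₀⟩ := eventually_atTop.1 (uniformlyApproximable_transpose_iff.1 h)
  set T := max T₀ 1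
  have hs := (hf.tendsto_posInv_atTop hf_inc).comp (tendsto_id.atTop_div_const (two_pos (α := ℝ)))
  rw [uniformlyApproximable_iff]
  filter_upwards [eventually_ge_atTop (2 * T), hs.eventually_ge_atTop T] with t ht hTs
  have hT : 1 ≤ T := le_max_right _ _
  obtain ⟨hs0, hfs, -⟩ := posInv_spec hf (show 0 < t / 2 by linarith)
  simp only [Function.comp_apply, id] at hTs
  set s := posInv (fun s => s * ψ s) (t / 2)
  obtain ⟨z, hz0, hhead, htail⟩ := exists_formMatrix_of_monotoneOn hψ hψ_dec hf_inc
    (one_pos.trans_le hT) hTs (by linarith) fun t' ht' =>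
      (hT₀ t' ((le_max_left _ _).trans ht')).imp fun w hw => ⟨ne_zero_of_abs_head_pos hw.1, hw.2⟩
  have hlt : 2 / (3 * s) < 1 := by
    rw [div_lt_one (by positivity)]
    linarith
  exact ⟨z, norm_tail_latticePoint_formMatrix_pos hz0 (hhead.trans_lt hlt), by linarith, hhead⟩

theorem monotoneOn_mul_posInv (hψ : PosInvertible ψ) (hψ_dec : AntitoneOn ψ (Ioi 0))
    (hf : AntitoneOn (fun t => t * ψ t) (Ioi 0)) :
    MonotoneOn (fun a => a * posInv ψ a) (Ioi 0) := by
  intro a ha b hb hab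
  obtain ⟨hpos_a, hspec_a, -⟩ := posInv_spec hψ ha
  obtain ⟨hpos_b, hspec_b, -⟩ := posInv_spec hψ hb
  calc a * posInv ψ a = posInv ψ a * ψ (posInv ψ a) := by rw [hspec_a, mul_comm]
    _ ≤ posInv ψ b * ψ (posInv ψ b) := hf hpos_b hpos_a (hψ.antitoneOn_posInv hψ_dec ha hb hab)
    _ = b * posInv ψ b := by rw [hspec_b, mul_comm]

theorem four_div_mul_posInv_lt (hψ : PosInvertible ψ) (hψ_dec : AntitoneOn ψ (Ioi 0))
    (hf : AntitoneOn (fun t => t * ψ t) (Ioi 0)) {C t : ℝ} (hC : 2 < C) (ht : 0 < t) :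
    4 / (3 * t) * posInv ψ (2 / (3 * t)) < C / t * posInv ψ (1 / t) := by
  have hle : 2 / (3 * t) ≤ 1 / t := by
    rw [div_le_div_iff₀ (by positivity) ht]
    linarith
  have hpos : 0 < posInv ψ (1 / t) := (posInv_spec hψ (by positivity)).1
  calc 4 / (3 * t) * posInv ψ (2 / (3 * t))
    _ = 2 * (2 / (3 * t) * posInv ψ (2 / (3 * t))) := by ring
    _ ≤ 2 * (1 / t * posInv ψ (1 / t)) :=
        mul_le_mul_of_nonneg_left (monotoneOn_mul_posInv hψ hψ_dec hf
          (mem_Ioi.2 (by positivity)) (mem_Ioi.2 (by positivity)) hle) two_pos.le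
    _ = 2 / t * posInv ψ (1 / t) := by ring
    _ < C / t * posInv ψ (1 / t) := by gcongr

theorem two_div_three_mul_lt {C S : ℝ} (hC : 1 < C) (hS : 0 < S) : 2 / (3 * S) < C / S := by
  rw [div_lt_div_iff₀ (by positivity) hS]
  nlinarith

end Main

theorem theorem9 (Θ : Matrix (Fin 1) (Fin 2) ℝ) (ψ : ℝ → ℝ)
    (hψ : PosInvertible ψ) (hψ_dec : AntitoneOn ψ (Ioi 0))
    (hf : PosInvertible (fun t => t * ψ t)) :
    (AntitoneOn (fun t => t * ψ t) (Ioi 0) →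
      (UniformlyApproximable Θ ψ →
        UniformlyApproximable Θᵀ (fun t => 4 / (3 * t) * posInv ψ (2 / (3 * t)))) ∧
      (∀ ε δ t : ℝ, 0 < ε → 0 < δ → 0 < t →
        4 / (3 * t) * posInv ψ (2 / (3 * t)) < 12 * (1 + ε + δ) / t * posInv ψ (1 / t))) ∧
    (MonotoneOn (fun t => t * ψ t) (Ioi 0) →
      (UniformlyApproximable Θᵀ ψ →
        UniformlyApproximable Θ (fun t => 2 / (3 * posInv (fun s => s * ψ s) (t / 2)))) ∧
      (∀ ε δ t : ℝ, 0 < ε → 0 < δ → 0 < t →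
        2 / (3 * posInv (fun s => s * ψ s) (t / 2))
          < 4 * (1 + ε + δ) / posInv (fun s => s * ψ s) (t / 2))) := by
  refine ⟨fun hf_dec => ⟨fun h => ?_, fun ε δ t hε hδ ht => ?_⟩,
    fun hf_inc => ⟨fun h => ?_, fun ε δ t hε hδ ht => ?_⟩⟩
  · exact h.transpose_of_antitoneOn hψ hψ_dec hf hf_dec
  · exact four_div_mul_posInv_lt hψ hψ_dec hf_dec (by linarith) ht
  · exact h.of_transpose_of_monotoneOn hψ hψ_dec hf hf_inc
  · exact two_div_three_mul_lt (by linarith) (posInv_spec hf (half_pos ht)).1
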